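/- There is a dense-separable Hausdorff topological group that is not hereditarily separable. More precisely, for $B\subseteq\mathbb R$ let $X_B$ be the Michael-type line over $B$, that is, the set $\mathbb R$ whose open sets are the sets $U\cup F$ with $U$ open in the Euclidean topology and $F\subseteq B$ (points of $B$ are isolated; all other points keep their Euclidean neighbourhoods). Let $C_p(X_B)$ be the additive group of continuous functions $X_B\to\mathbb R$ with the topology of pointwise convergence. Then there is a Bernstein set $B\subseteq\mathbb R$ (a set that meets every uncountable closed subset of $\mathbb R$ and contains none), consisting of irrational numbers, such that $X_B$ is not hereditarily Lindelöf and $C_p(X_B)$ is a Hausdorff topological group which is separable, has countable tightness (whenever $f\in\overline{A}$ there is a countable $D\subseteq A$ with $f\in\overline{D}$) and is dense-separable (every dense subspace is separable), but is not hereditarily separable (some subspace is not separable). -/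

import Mathlib

open Set Topology TopologicalSpace

/-- A subset of the real line is a Bernstein set if it meets every uncountable closed set and
contains none of them. -/
def IsBernstein (B : Set ℝ) : Prop :=
  ∀ C : Set ℝ, IsClosed C → ¬ C.Countable → (C ∩ B).Nonempty ∧ (C \ B).Nonempty

/-- The Michael-type line over `B`: the real numbers with the points of `B` made isolated
and with the Euclidean neighbourhoods kept at all other points. -/
def MichaelLine (_B : Set ℝ) : Type := ℝ

/-- The open sets are the unions of a Euclidean open set and a subset of `B`. -/
instance MichaelLine.instTopologicalSpace (B : Set ℝ) : TopologicalSpace (MichaelLine B) where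
  IsOpen s := ∃ U F : Set ℝ, IsOpen U ∧ F ⊆ B ∧ s = U ∪ F
  isOpen_univ := ⟨univ, ∅, isOpen_univ, empty_subset _, (union_empty _).symm⟩
  isOpen_inter := by
    rintro s t ⟨U, F, hU, hF, rfl⟩ ⟨V, E, hV, hE, rfl⟩
    refine ⟨U ∩ V, (U ∩ E) ∪ (F ∩ V) ∪ (F ∩ E), hU.inter hV, ?_, ?_⟩
    · rintro x ((hx | hx) | hx)
      · exact hE hx.2
      · exact hF hx.1
      · exact hF hx.1
    · ext x
      change (x ∈ U ∨ x ∈ F) ∧ (x ∈ V ∨ x ∈ E) ↔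
        (x ∈ U ∧ x ∈ V) ∨ (((x ∈ U ∧ x ∈ E) ∨ (x ∈ F ∧ x ∈ V)) ∨ (x ∈ F ∧ x ∈ E))
      tauto
  isOpen_sUnion := by
    intro S hS
    choose U F hU hF hUF using hS
    refine ⟨⋃ s, ⋃ h : s ∈ S, U s h, ⋃ s, ⋃ h : s ∈ S, F s h,
      isOpen_iUnion fun s => isOpen_iUnion fun h => hU s h,
      iUnion_subset fun s => iUnion_subset fun h => hF s h, ?_⟩
    have key : ∀ (s : Set (MichaelLine B)) (h : s ∈ S) (x : ℝ),
        (show Set ℝ from s) x ↔ x ∈ U s h ∨ x ∈ F s h := by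
      intro s h x
      exact Set.ext_iff.mp (hUF s h) x
    ext x
    constructor
    · rintro ⟨s, hs, hx⟩
      rcases (key s hs x).1 hx with h | h
      · exact Or.inl (mem_iUnion₂.2 ⟨s, hs, h⟩)
      · exact Or.inr (mem_iUnion₂.2 ⟨s, hs, h⟩)
    · rintro (h | h)
      · obtain ⟨s, hs, h⟩ := mem_iUnion₂.1 h
        exact ⟨s, hs, (key s hs x).2 (Or.inl h)⟩
      · obtain ⟨s, hs, h⟩ := mem_iUnion₂.1 h
        exact ⟨s, hs, (key s hs x).2 (Or.inr h)⟩

/-- `C_p(X)`: the additive group of continuous real-valued functions on `X` with the topology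
of pointwise convergence, realised as a subgroup of the product `X → ℝ` (the subspace
topology of the product topology is found by instance search). -/
def Cp (X : Type*) [TopologicalSpace X] : AddSubgroup (X → ℝ) where
  carrier := {f | Continuous f}
  zero_mem' := continuous_const
  add_mem' := fun hf hg => Continuous.add hf hg
  neg_mem' := fun hf => Continuous.neg hf

/-- Countable tightness: every point of the closure of a set lies in the closure of a countable
subset of that set. -/
def CountablyTight (X : Type*) [TopologicalSpace X] : Prop :=
  ∀ (A : Set X) (x : X), x ∈ closure A → ∃ D ⊆ A, D.Countable ∧ x ∈ closure D

/-- Every dense subspace is separable. -/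
def DenseSeparable (X : Type*) [TopologicalSpace X] : Prop :=
  ∀ D : Set X, Dense D → SeparableSpace D

/-- Every subspace is separable. -/
def HereditarilySeparable (X : Type*) [TopologicalSpace X] : Prop :=
  ∀ A : Set X, SeparableSpace A

/-!
The spaces `C_p(X)` with all finite powers of `X` Lindelöf are countably tight (`Cp.countablyTight`,
one half of the Arhangel'skii–Pytkeev theorem), and a separable countably tight space is
dense-separable: approximate each point of a countable dense set by a countable part of the given
dense subspace. `C_p(X_B)` is separable because `X_B` maps continuously and injectively to `ℝ`, so
that polynomials already interpolate on finite sets. It is not hereditarily separable because the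
indicators of the uncountably many isolated points form a discrete subspace. What remains is to
find a Bernstein set `B` for which every finite power of `X_B` is Lindelöf.

Let `A` be the complement of `B`. At the points of `A^n` the space `X_B^n` has its Euclidean
neighbourhoods, so countably many members of an open cover of `X_B^n` cover a Euclidean open
set containing `A^n`. If its closed complement `C` lies in countably many hyperplanes `x i = c`,
then these are copies of `X_B^(n-1)` and induction finishes the proof
(`MichaelLine.lindelofSpace_pi`). So it suffices that `A^n` meets every closed `C ⊆ ℝ^n` that is not
covered by countably many hyperplanes; such sets are called `CoordinatewiseUncountable` below.

Such a `C` is not even covered by fewer than continuum many hyperplanes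
(`CoordinatewiseUncountable.exists_avoiding`): a Cantor scheme inside `C` yields a copy of the
Cantor set on which every coordinate is injective. As there are only continuum many closed sets, a
transfinite recursion (`exists_disjoint_finset_selection`) picks in each of them one point whose
coordinates go to `A` and one whose coordinates go to `B`
(`exists_coordinatewise_bernstein`). The case `n = 1` says that `B` is a Bernstein set.
-/

/-! ### Cantor sets with injective coordinates -/

open Filter Metric in
/-- The splitting step of the Cantor scheme: a ball around a point of `K` contains two smaller balls
around points of `K` whose images under each coordinate projection are disjoint. -/
theorem exists_separated_closedBalls {ι : Type*} [Fintype ι] {K : Set (ι → ℝ)}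
    (hK : ∀ x ∈ K, ∀ ε > 0, ∃ y ∈ K, dist y x < ε ∧ ∀ i, y i ≠ x i)
    {x : ι → ℝ} (hx : x ∈ K) {r : ℝ} (hr : 0 < r) :
    ∃ y ∈ K, ∃ s, 0 < s ∧ s ≤ r / 2 ∧ closedBall y s ⊆ closedBall x r ∧
      ∀ u ∈ closedBall x s, ∀ v ∈ closedBall y s, ∀ i, u i ≠ v i := by
  obtain ⟨y, hyK, hyx, hne⟩ := hK x hx (r / 2) (by linarith)
  have hev : ∀ᶠ s in 𝓝[>] (0 : ℝ), 0 < s ∧ s < r / 2 ∧ ∀ i, s < dist (y i) (x i) / 2 := by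
    refine (eventually_mem_nhdsWithin).and (nhdsWithin_le_nhds ?_)
    refine (eventually_lt_nhds (by linarith)).and (eventually_all.2 fun i => ?_)
    exact eventually_lt_nhds (by have := dist_pos.2 (hne i); linarith)
  obtain ⟨s, hs0, hsr, hs⟩ := hev.exists
  refine ⟨y, hyK, s, hs0, hsr.le, closedBall_subset_closedBall' (by linarith), ?_⟩
  intro u hu v hv i huv
  have h1 := (dist_le_pi_dist u x i).trans hu
  have h2 := (dist_le_pi_dist v y i).trans hv
  have h3 := dist_triangle_left (y i) (x i) (u i)
  rw [huv] at h3 h1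
  linarith [hs i]

open Filter Metric CantorScheme PiNat in
/-- If each point of `K` is a limit of points of `K` differing from it in every coordinate, then
a closed set containing `K` contains the image of a map from the Cantor space each of whose
coordinates is injective. -/
theorem exists_coordinatewise_injective {ι : Type*} [Fintype ι] {C K : Set (ι → ℝ)}
    (hC : IsClosed C) (hKC : K ⊆ C) (hne : K.Nonempty)
    (hK : ∀ x ∈ K, ∀ ε > 0, ∃ y ∈ K, dist y x < ε ∧ ∀ i, y i ≠ x i) :
    ∃ f : (ℕ → Bool) → ι → ℝ, (∀ z, f z ∈ C) ∧ ∀ i, Function.Injective fun z => f z i := by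
  classical
  choose! c hcK s hs0 hsr hsub hsep using
    fun (x : ι → ℝ) (hx : x ∈ K) (r : ℝ) (hr : 0 < r) => exists_separated_closedBalls hK hx hr
  obtain ⟨x₀, hx₀⟩ := hne
  -- `P l` is the centre and the radius of the ball at the node `l` of the scheme
  let P : List Bool → (ι → ℝ) × ℝ := fun l =>
    l.rec (x₀, 1) fun b _ p => (if b then c p.1 p.2 else p.1, s p.1 p.2)
  have hP : ∀ l, (P l).1 ∈ K ∧ 0 < (P l).2 := by
    intro l
    induction l with
    | nil => exact ⟨hx₀, one_pos⟩
    | cons b l ih =>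
      refine ⟨?_, hs0 _ ih.1 _ ih.2⟩
      cases b
      · exact ih.1
      · exact hcK _ ih.1 _ ih.2
  have hrad : ∀ l, (P l).2 ≤ (1 / 2) ^ l.length := by
    intro l
    induction l with
    | nil => exact le_of_eq (pow_zero _).symm
    | cons b l ih =>
      have := hsr _ (hP l).1 _ (hP l).2
      rw [List.length_cons, pow_succ]
      change s (P l).1 (P l).2 ≤ _
      linarith
  let D : List Bool → Set (ι → ℝ) := fun l => closedBall (P l).1 (P l).2
  have hanti : ClosureAntitone D := by
    refine Antitone.closureAntitone ?_ fun l => isClosed_closedBall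
    intro l b
    cases b
    · refine closedBall_subset_closedBall ?_
      have := hsr _ (hP l).1 _ (hP l).2
      have := (hP l).2
      change s (P l).1 (P l).2 ≤ _
      linarith
    · exact hsub _ (hP l).1 _ (hP l).2
  have hpow : Tendsto (fun n : ℕ => 2 * ENNReal.ofReal ((1 / 2 : ℝ) ^ n)) atTop (𝓝 0) := by
    have h := ENNReal.tendsto_ofReal
      (tendsto_pow_atTop_nhds_zero_of_lt_one (r := (1 / 2 : ℝ)) (by norm_num) (by norm_num))
    simpa using ENNReal.Tendsto.const_mul h (Or.inr (by norm_num : (2 : ENNReal) ≠ ⊤))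
  have hdiam : VanishingDiam D := by
    intro z
    refine tendsto_of_tendsto_of_tendsto_of_le_of_le tendsto_const_nhds hpow
      (fun _ => zero_le) fun n => ?_
    refine ediam_le fun u hu v hv => ?_
    have hn := hrad (res z n)
    rw [res_length] at hn
    have h2 : dist u v ≤ 2 * (1 / 2) ^ n := by
      have := dist_triangle_right u v (P (res z n)).1
      have := mem_closedBall.1 hu
      have := mem_closedBall.1 hv
      linarith
    rw [edist_dist]
    refine (ENNReal.ofReal_le_ofReal h2).trans_eq ?_
    rw [ENNReal.ofReal_mul (by norm_num)]
    simp
  have hdom : ∀ z : ℕ → Bool, z ∈ (inducedMap D).1 := fun z => by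
    rw [hanti.map_of_vanishingDiam hdiam fun l => ⟨_, mem_closedBall_self (hP l).2.le⟩]
    exact mem_univ z
  let f : (ℕ → Bool) → ι → ℝ := fun z => (inducedMap D).2 ⟨z, hdom z⟩
  have hf : ∀ z n, f z ∈ D (res z n) := fun z n => map_mem ⟨z, hdom z⟩ n
  refine ⟨f, fun z => ?_, fun i z w hzw => ?_⟩
  · -- the centres along the branch `z` lie in `K ⊆ C` and converge to `f z`
    refine hC.closure_subset (Metric.mem_closure_iff.2 fun ε hε => ?_)
    obtain ⟨n, hn⟩ := hdiam.dist_lt ε hε z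
    exact ⟨_, hKC (hP (res z n)).1, hn _ (hf z n) _ (mem_closedBall_self (hP _).2.le)⟩
  · apply res_injective
    ext n : 1
    induction n with
    | zero => simp
    | succ n ih =>
      simp only [res_succ, List.cons.injEq]
      refine ⟨?_, ih⟩
      by_contra hne
      have hz := hf z (n + 1)
      have hw := hf w (n + 1)
      rw [res_succ] at hz hw
      rw [← ih] at hw
      have key := hsep _ (hP (res z n)).1 _ (hP (res z n)).2
      cases hzn : z n <;> cases hwn : w n <;> rw [hzn] at hz hne <;> rw [hwn] at hw hne
      · exact hne rfl
      · exact key _ hz _ hw i hzw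
      · exact key _ hw _ hz i hzw.symm
      · exact hne rfl

/-! ### Closed sets not covered by countably many hyperplanes -/

/-- A set `C ⊆ ℝ^ι` is coordinatewise uncountable if it is not covered by countably many
hyperplanes `{x | x i = c}`. It is harmless to let all coordinates `i` share one countable set `T`
of values `c`. For a singleton `ι` this says that `C` is uncountable. -/
def CoordinatewiseUncountable {ι : Type*} (C : Set (ι → ℝ)) : Prop :=
  ∀ T : Set ℝ, T.Countable → ∃ x ∈ C, ∀ i, x i ∉ T

/-- An analogue of the Cantor–Bendixson theorem: removing from `C` the countably many hyperplanes
that cover the small basic open parts of `C` leaves a set `K` without points isolated in the sense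
of `exists_coordinatewise_injective`. -/
theorem CoordinatewiseUncountable.exists_condensation {ι : Type*} [Fintype ι] {C : Set (ι → ℝ)}
    (hC : CoordinatewiseUncountable C) :
    ∃ K ⊆ C, K.Nonempty ∧ ∀ x ∈ K, ∀ ε > 0, ∃ y ∈ K, dist y x < ε ∧ ∀ i, y i ≠ x i := by
  classical
  have hT : ∀ V : Set (ι → ℝ), ∃ T : Set ℝ, T.Countable ∧
      (¬ CoordinatewiseUncountable (C ∩ V) → ∀ x ∈ C ∩ V, ∃ i, x i ∈ T) := by
    intro V
    by_cases h : CoordinatewiseUncountable (C ∩ V)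
    · exact ⟨∅, countable_empty, fun h' => absurd h h'⟩
    · have h' := h
      unfold CoordinatewiseUncountable at h'
      push Not at h'
      obtain ⟨T, hTc, hT⟩ := h'
      exact ⟨T, hTc, fun _ => hT⟩
  choose T hTc hT using hT
  let b := countableBasis (ι → ℝ)
  let T₀ : Set ℝ := ⋃ V ∈ b, T V
  have hT₀ : T₀.Countable := (countable_countableBasis _).biUnion fun V _ => hTc V
  let K : Set (ι → ℝ) := {x ∈ C | ∀ i, x i ∉ T₀}
  refine ⟨K, fun x hx => hx.1, hC T₀ hT₀, fun x hx ε hε => ?_⟩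
  obtain ⟨V, hVb, hxV, hVε⟩ := (isBasis_countableBasis (ι → ℝ)).mem_nhds_iff.1
    (Metric.ball_mem_nhds x hε)
  have hbig : CoordinatewiseUncountable (C ∩ V) := by
    by_contra h
    obtain ⟨i, hi⟩ := hT V h x ⟨hx.1, hxV⟩
    exact hx.2 i (mem_biUnion hVb hi)
  obtain ⟨y, hy, hyT⟩ := hbig (T₀ ∪ range x) (hT₀.union (countable_range x))
  exact ⟨y, ⟨hy.1, fun i h => hyT i (Or.inl h)⟩, hVε hy.2,
    fun i h => hyT i (Or.inr ⟨i, h.symm⟩)⟩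

open Cardinal in
/-- A closed set that is not covered by countably many hyperplanes `{x | x i = c}` is not covered by
fewer than continuum many. -/
theorem CoordinatewiseUncountable.exists_avoiding {ι : Type} [Fintype ι] {C : Set (ι → ℝ)}
    (hC : CoordinatewiseUncountable C) (hcl : IsClosed C) {T : Set ℝ} (hT : #T < 𝔠) :
    ∃ x ∈ C, ∀ i, x i ∉ T := by
  obtain ⟨K, hKC, hne, hK⟩ := hC.exists_condensation
  obtain ⟨f, hfC, hf⟩ := exists_coordinatewise_injective hcl hKC hne hK
  by_contra! h
  choose i hi using fun z => h (f z) (hfC z)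
  -- by injectivity of the coordinates, a branch is recovered from a coordinate and its value there
  have hinj : Function.Injective fun z => (i z, (⟨f z (i z), hi z⟩ : T)) := by
    intro z w hzw
    simp only [Prod.mk.injEq, Subtype.mk.injEq] at hzw
    refine hf (i z) ?_
    change f z (i z) = f w (i z)
    rw [hzw.2, hzw.1]
  have hle := mk_le_of_injective hinj
  rw [mk_prod, lift_id, lift_id] at hle
  have hlt : #ι * #T < 𝔠 :=
    mul_lt_of_lt aleph0_le_continuum ((lt_aleph0_of_finite ι).trans_le aleph0_le_continuum) hT
  exact (hle.trans_lt hlt).ne (by simp)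

/-! ### Construction of the Bernstein set -/

open Cardinal in
/-- A Bernstein-type transfinite recursion: if each of at most `κ` families of finite sets has
members avoiding any prescribed set of size less than `κ`, two members can be selected from each
family so that no first choice meets a second choice, and the second choices avoid `Q`. -/
theorem exists_disjoint_finset_selection {ι α : Type} {κ : Cardinal} (hκ : ℵ₀ < κ)
    (hι : #ι ≤ κ) (S : ι → Set (Finset α))
    (hS : ∀ i, ∀ T : Set α, #T < κ → ∃ F ∈ S i, ∀ a ∈ F, a ∉ T) {Q : Set α} (hQ : #Q < κ) :
    ∃ f g : ι → Finset α, (∀ i, f i ∈ S i) ∧ (∀ i, g i ∈ S i) ∧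
      (∀ i, ∀ a ∈ g i, a ∉ Q) ∧ ∀ i j, ∀ a ∈ f i, a ∉ g j := by
  classical
  obtain ⟨r, hr, hord⟩ := exists_ord_eq ι
  have hpick : ∀ i, ∀ T : Set α, ∃ F : Finset α, #T < κ → F ∈ S i ∧ ∀ a ∈ F, a ∉ T := by
    intro i T
    by_cases h : #T < κ
    · obtain ⟨F, hF⟩ := hS i T h
      exact ⟨F, fun _ => hF⟩
    · exact ⟨∅, fun h' => absurd h' h⟩
  choose pick hpick using hpick
  -- all elements chosen before stage `i`
  let used : ∀ i, (∀ j, r j i → Finset α × Finset α) → Set α := fun i p =>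
    ⋃ j : {j // r j i}, (↑((p j.1 j.2).1 ∪ (p j.1 j.2).2) : Set α)
  let step : ∀ i, (∀ j, r j i → Finset α × Finset α) → Finset α × Finset α := fun i p =>
    (pick i (used i p), pick i (used i p ∪ pick i (used i p) ∪ Q))
  let h : ι → Finset α × Finset α := IsWellFounded.fix r step
  have hh : ∀ i, h i = step i fun j _ => h j := fun i => IsWellFounded.fix_eq r step i
  let U : ι → Set α := fun i => used i fun j _ => h j
  have hU : ∀ i, #(U i) < κ := by
    intro i
    refine (mk_iUnion_le _).trans_lt (mul_lt_of_lt hκ.le ?_ ?_)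
    · exact (card_typein_lt i hord).trans_le hι
    · refine (ciSup_le' fun j => ?_).trans_lt hκ
      exact (lt_aleph0_of_finite _).le
  have hU' : ∀ i, #(U i ∪ (h i).1 ∪ Q : Set α) < κ := by
    intro i
    refine (mk_union_le _ _).trans_lt (add_lt_of_lt hκ.le ?_ hQ)
    refine (mk_union_le _ _).trans_lt (add_lt_of_lt hκ.le (hU i) ?_)
    exact (lt_aleph0_of_finite _).trans hκ
  have h1 : ∀ i, (h i).1 = pick i (U i) := fun i => by rw [hh i]
  have h2 : ∀ i, (h i).2 = pick i (U i ∪ (h i).1 ∪ Q) := fun i => by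
    rw [h1 i]; rw [hh i]
  have hf : ∀ i, (h i).1 ∈ S i ∧ ∀ a ∈ (h i).1, a ∉ U i := fun i => by
    rw [h1 i]; exact hpick i _ (hU i)
  have hg : ∀ i, (h i).2 ∈ S i ∧ ∀ a ∈ (h i).2, a ∉ U i ∪ (h i).1 ∪ Q := fun i => by
    have := hpick i _ (hU' i)
    rwa [← h2 i] at this
  refine ⟨fun i => (h i).1, fun i => (h i).2, fun i => (hf i).1, fun i => (hg i).1,
    fun i a ha haQ => (hg i).2 a ha (Or.inr haQ), fun i j a hai haj => ?_⟩
  rcases trichotomous_of r i j with hij | rfl | hji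
  · exact (hg j).2 a haj (Or.inl (Or.inl
      (mem_iUnion.2 ⟨⟨i, hij⟩, Finset.mem_coe.2 (Finset.mem_union_left _ hai)⟩)))
  · exact (hg i).2 a haj (Or.inl (Or.inr hai))
  · exact (hf i).2 a hai
      (mem_iUnion.2 ⟨⟨j, hji⟩, Finset.mem_coe.2 (Finset.mem_union_right _ haj)⟩)

open Cardinal in
/-- There is a set `B` of irrationals such that every power `B^n` and every power of the complement
meets each closed coordinatewise uncountable subset of `ℝ^n`. -/
theorem exists_coordinatewise_bernstein :
    ∃ B : Set ℝ, (∀ b ∈ B, Irrational b) ∧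
      ∀ (n : ℕ) (C : Set (Fin n → ℝ)), IsClosed C → CoordinatewiseUncountable C →
        (∃ x ∈ C, ∀ i, x i ∈ B) ∧ ∃ x ∈ C, ∀ i, x i ∉ B := by
  classical
  let I : Type := Σ n : ℕ, {C : Set (Fin n → ℝ) // IsClosed C ∧ CoordinatewiseUncountable C}
  have hI : #I ≤ 𝔠 := by
    rw [mk_sigma]
    refine (sum_le_sum _ (fun _ => 𝔠) fun n => ?_).trans (by simp)
    obtain ⟨b, hb, hgen⟩ := MeasurableSpace.CountablyGenerated.isCountablyGenerated
      (α := Fin n → ℝ)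
    have hcard := MeasurableSpace.cardinal_measurableSet_le_continuum
      (hb.le_aleph0.trans aleph0_le_continuum)
    rw [← hgen] at hcard
    exact (mk_le_mk_of_subset fun C hC => hC.1.measurableSet).trans hcard
  obtain ⟨f, g, hf, hg, hgQ, hfg⟩ := exists_disjoint_finset_selection aleph0_lt_continuum hI
    (fun C => {F | ∃ x ∈ C.2.1, F = Finset.univ.image x})
    (by
      rintro ⟨n, C, hcl, hC⟩ T hT
      obtain ⟨x, hxC, hxT⟩ := hC.exists_avoiding hcl hT
      refine ⟨_, ⟨x, hxC, rfl⟩, fun a ha => ?_⟩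
      obtain ⟨i, -, rfl⟩ := Finset.mem_image.1 ha
      exact hxT i)
    (Q := range ((↑) : ℚ → ℝ))
    ((countable_range _).le_aleph0.trans_lt aleph0_lt_continuum)
  refine ⟨⋃ j, (g j : Set ℝ), fun b hb => ?_, fun n C hcl hC => ?_⟩
  · obtain ⟨j, hj⟩ := mem_iUnion.1 hb
    exact hgQ j b hj
  · obtain ⟨x, hxC, hx⟩ := hf ⟨n, C, hcl, hC⟩
    obtain ⟨y, hyC, hy⟩ := hg ⟨n, C, hcl, hC⟩
    refine ⟨⟨y, hyC, fun i => mem_iUnion.2 ⟨⟨n, C, hcl, hC⟩, ?_⟩⟩, x, hxC, fun i hi => ?_⟩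
    · rw [hy]
      exact Finset.mem_coe.2 (Finset.mem_image_of_mem _ (Finset.mem_univ i))
    · obtain ⟨j, hj⟩ := mem_iUnion.1 hi
      refine hfg ⟨n, C, hcl, hC⟩ j (x i) ?_ hj
      rw [hx]
      exact Finset.mem_image_of_mem _ (Finset.mem_univ i)

theorem isBernstein_of_forall_fin_one {B : Set ℝ}
    (hB : ∀ C : Set (Fin 1 → ℝ), IsClosed C → CoordinatewiseUncountable C →
      (∃ x ∈ C, ∀ i, x i ∈ B) ∧ ∃ x ∈ C, ∀ i, x i ∉ B) : IsBernstein B := by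
  intro C hC hunc
  have hbig : CoordinatewiseUncountable {x : Fin 1 → ℝ | x 0 ∈ C} := by
    intro T hT
    obtain ⟨c, hc, hcT⟩ := not_subset.1 fun h => hunc (hT.mono h)
    exact ⟨fun _ => c, hc, fun _ => hcT⟩
  obtain ⟨⟨x, hxC, hx⟩, y, hyC, hy⟩ := hB _ (hC.preimage (continuous_apply 0)) hbig
  exact ⟨⟨x 0, hxC, hx 0⟩, y 0, hyC, hy 0⟩

open MeasureTheory in
/-- The complement of a countable set has positive measure, hence contains an uncountable compact
set, which a Bernstein set would have to meet. -/
theorem IsBernstein.not_countable {B : Set ℝ} (hB : IsBernstein B) : ¬ B.Countable := by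
  intro hc
  have hpos : 0 < volume Bᶜ := by
    rw [measure_compl hc.measurableSet (by simp [hc.measure_zero]), hc.measure_zero]
    simp
  obtain ⟨C, hCB, hC, hCpos⟩ := hc.measurableSet.compl.exists_lt_isCompact hpos
  obtain ⟨x, hxC, hxB⟩ := (hB C hC.isClosed fun h => hCpos.ne' (h.measure_zero _)).1
  exact hCB hxC hxB

/-! ### The Michael-type line -/

namespace MichaelLine

variable {B : Set ℝ}

/-- The identity map from the Michael-type line to the real line with its Euclidean topology. -/
def toReal (x : MichaelLine B) : ℝ := x

theorem continuous_toReal : Continuous (toReal : MichaelLine B → ℝ) :=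
  continuous_def.2 fun U hU => ⟨U, ∅, hU, empty_subset _, (union_empty _).symm⟩

theorem toReal_injective : Function.Injective (toReal : MichaelLine B → ℝ) := fun _ _ h => h

instance instT2Space : T2Space (MichaelLine B) :=
  T2Space.of_injective_continuous toReal_injective continuous_toReal

theorem isOpen_singleton {b : MichaelLine B} (hb : b.toReal ∈ B) : IsOpen ({b} : Set _) :=
  ⟨∅, {b.toReal}, isOpen_empty, singleton_subset_iff.2 hb, (empty_union _).symm⟩

theorem nhds_eq_comap {a : MichaelLine B} (ha : a.toReal ∉ B) :
    𝓝 a = (𝓝 a.toReal).comap toReal := by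
  refine le_antisymm (continuous_toReal.continuousAt (x := a)).le_comap fun s hs => ?_
  obtain ⟨t, hts, ⟨U, F, hU, hF, rfl⟩, hat⟩ := mem_nhds_iff.1 hs
  have haU : a.toReal ∈ U := hat.resolve_right fun h => ha (hF h)
  exact ⟨U, hU.mem_nhds haU, fun y hy => hts (Or.inl hy)⟩

/-- If the powers of the complement of `B` meet all closed coordinatewise uncountable sets, all
finite powers of the Michael-type line over `B` are Lindelöf. -/
theorem lindelofSpace_pi
    (hB : ∀ (n : ℕ) (C : Set (Fin n → ℝ)), IsClosed C → CoordinatewiseUncountable C →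
      ∃ x ∈ C, ∀ i, x i ∉ B) (n : ℕ) : LindelofSpace (Fin n → MichaelLine B) := by
  induction n with
  | zero => infer_instance
  | succ n ih =>
    rw [← isLindelof_univ_iff]
    refine isLindelof_of_countable_subcover fun {κ} O hO hcov => ?_
    let e : (Fin (n + 1) → MichaelLine B) → Fin (n + 1) → ℝ := fun x i => (x i).toReal
    -- points with no coordinate in `B` have their Euclidean neighbourhoods
    have hnhds : ∀ x : Fin (n + 1) → MichaelLine B, (∀ i, (x i).toReal ∉ B) →
        𝓝 x = (𝓝 (e x)).comap e := by
      intro x hx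
      simp only [nhds_pi, Filter.pi, Filter.comap_iInf, Filter.comap_comap]
      refine iInf_congr fun i => ?_
      rw [nhds_eq_comap (hx i), Filter.comap_comap]
      rfl
    have hU : ∀ x : {x : Fin (n + 1) → MichaelLine B // ∀ i, (x i).toReal ∉ B},
        ∃ k, ∃ U : Set (Fin (n + 1) → ℝ), IsOpen U ∧ e x.1 ∈ U ∧ e ⁻¹' U ⊆ O k := by
      rintro ⟨x, hx⟩
      obtain ⟨k, hk⟩ := mem_iUnion.1 (hcov (mem_univ x))
      have := (hO k).mem_nhds hk
      rw [hnhds x hx] at this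
      obtain ⟨V, hV, hVO⟩ := this
      obtain ⟨U, hUV, hU, hxU⟩ := mem_nhds_iff.1 hV
      exact ⟨k, U, hU, hxU, (preimage_mono hUV).trans hVO⟩
    choose k U hUo hxU hUO using hU
    obtain ⟨t, htc, ht⟩ := eq_open_union_countable U hUo
    have hsmall : ¬ CoordinatewiseUncountable (⋃ x, U x)ᶜ := by
      intro hbig
      obtain ⟨x, hxC, hx⟩ := hB _ _ (isOpen_iUnion hUo).isClosed_compl hbig
      exact hxC (mem_iUnion.2 ⟨⟨x, hx⟩, hxU ⟨x, hx⟩⟩)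
    unfold CoordinatewiseUncountable at hsmall
    push Not at hsmall
    obtain ⟨T, hTc, hT⟩ := hsmall
    -- the hyperplanes covering what the Euclidean open sets `U` leave out, each a copy of the
    -- `n`-th power
    let H : Set (Fin (n + 1) → MichaelLine B) :=
      ⋃ i : Fin (n + 1), ⋃ c ∈ T, range fun y : Fin n → MichaelLine B =>
        i.insertNth (α := fun _ => MichaelLine B) c y
    have hH : IsLindelof H := isLindelof_iUnion fun i => hTc.isLindelof_biUnion fun c _ =>
      isLindelof_range (continuous_const.finInsertNth i continuous_id)
    obtain ⟨r, hrc, hr⟩ := hH.elim_countable_subcover O hO ((subset_univ _).trans hcov)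
    refine ⟨k '' t ∪ r, (htc.image k).union hrc, fun x _ => ?_⟩
    by_cases hx : e x ∈ ⋃ x, U x
    · rw [← ht] at hx
      obtain ⟨z, hz, hxz⟩ := mem_iUnion₂.1 hx
      exact mem_biUnion (Or.inl (mem_image_of_mem k hz)) (hUO z hxz)
    · obtain ⟨i, hi⟩ := hT (e x) hx
      have hxH : x ∈ H := by
        refine mem_iUnion.2 ⟨i, mem_biUnion hi ⟨fun j => x (i.succAbove j), ?_⟩⟩
        exact Fin.insertNth_self_removeNth i x
      obtain ⟨j, hj, hxj⟩ := mem_iUnion₂.1 (hr hxH)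
      exact mem_biUnion (Or.inr hj) hxj

theorem discreteTopology_isolated : DiscreteTopology (toReal ⁻¹' B : Set (MichaelLine B)) :=
  discreteTopology_iff_isOpen_singleton.2 fun b =>
    ⟨{b.1}, isOpen_singleton b.2, by ext; simp [Subtype.ext_iff]⟩

theorem not_hereditarilyLindelofSpace (hB : ¬ B.Countable) :
    ¬ HereditarilyLindelofSpace (MichaelLine B) := fun _ =>
  hB ((HereditarilyLindelofSpace.isLindelof (toReal ⁻¹' B : Set (MichaelLine B))).countable
    discreteTopology_isolated)

end MichaelLine

/-! ### Spaces of continuous functions with the pointwise topology -/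

section Cp

variable {X : Type*} [TopologicalSpace X]

theorem Cp.continuous_eval (x : X) : Continuous fun f : Cp X => f.1 x :=
  (continuous_apply x).comp continuous_subtype_val

theorem Cp.mem_closure_iff {D : Set (Cp X)} {f : Cp X} :
    f ∈ closure D ↔ ∀ (n : ℕ) (x : Fin n → X) (ε : ℝ), 0 < ε →
      ∃ g ∈ D, ∀ i, dist (g.1 (x i)) (f.1 (x i)) < ε := by
  constructor
  · intro hf n x ε hε
    have hev : ∀ᶠ g : Cp X in 𝓝 f, ∀ i, dist (g.1 (x i)) (f.1 (x i)) < ε :=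
      Filter.eventually_all.2 fun i =>
        (Cp.continuous_eval (x i)).continuousAt.eventually (Metric.ball_mem_nhds _ hε)
    obtain ⟨g, hg, hgD⟩ := mem_closure_iff_nhds.1 hf _ hev
    exact ⟨g, hgD, hg⟩
  · intro h
    refine mem_closure_iff_nhds.2 fun s hs => ?_
    rw [nhds_subtype_eq_comap, nhds_pi] at hs
    obtain ⟨t, ht, hts⟩ := hs
    obtain ⟨I, hI, V, hV, hVt⟩ := Filter.mem_pi.1 ht
    have hV' : ∀ x, ∃ ε > 0, Metric.ball (f.1 x) ε ⊆ V x := fun x => Metric.mem_nhds_iff.1 (hV x)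
    choose ε hε hεV using hV'
    obtain ⟨n, x, -, rfl⟩ := hI.fin_param
    obtain ⟨δ, hδ, hδx⟩ : ∃ δ > 0, ∀ i, δ < ε (x i) := by
      have : ∀ᶠ δ in 𝓝[>] (0 : ℝ), 0 < δ ∧ ∀ i, δ < ε (x i) :=
        eventually_mem_nhdsWithin.and (nhdsWithin_le_nhds
          (Filter.eventually_all.2 fun i => eventually_lt_nhds (hε _)))
      exact this.exists
    obtain ⟨g, hgD, hg⟩ := h n x δ hδ
    refine ⟨g, hts (hVt ?_), hgD⟩
    rintro _ ⟨i, rfl⟩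
    exact hεV _ ((hg i).trans (hδx i))

/-- The Arhangel'skii–Pytkeev theorem, in one direction: if `f` is in the closure of `A`, then for
each `n` and each error `1 / (m + 1)` a countable subcover of `X^n` yields countably many members
of `A` that approximate `f` at all `n`-tuples of points. -/
theorem Cp.countablyTight (hX : ∀ n : ℕ, LindelofSpace (Fin n → X)) : CountablyTight (Cp X) := by
  intro A f hf
  have key : ∀ n m : ℕ, ∃ D ⊆ A, D.Countable ∧
      ∀ x : Fin n → X, ∃ g ∈ D, ∀ i, dist (g.1 (x i)) (f.1 (x i)) < 1 / ((m : ℝ) + 1) := by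
    intro n m
    choose g hgA hg using fun x : Fin n → X =>
      Cp.mem_closure_iff.1 hf n x (1 / ((m : ℝ) + 1)) Nat.one_div_pos_of_nat
    have hO : ∀ x, {y : Fin n → X | ∀ i, dist ((g x).1 (y i)) (f.1 (y i)) < 1 / ((m : ℝ) + 1)} ∈
        𝓝 x := by
      intro x
      refine Filter.eventually_all.2 fun i => ?_
      have hc : Continuous fun y : Fin n → X => dist ((g x).1 (y i)) (f.1 (y i)) :=
        ((g x).2.comp (continuous_apply i)).dist (f.2.comp (continuous_apply i))
      exact hc.continuousAt.eventually (eventually_lt_nhds (hg x i))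
    obtain ⟨t, htc, ht⟩ := (hX n).elim_nhds_subcover _ hO
    refine ⟨g '' t, image_subset_iff.2 fun x _ => hgA x, htc.image g, fun y => ?_⟩
    obtain ⟨x, hx, hy⟩ := mem_iUnion₂.1 (ht.ge (mem_univ y))
    exact ⟨g x, mem_image_of_mem g hx, hy⟩
  choose D hDA hDc hD using key
  refine ⟨⋃ n, ⋃ m, D n m, iUnion₂_subset hDA,
    countable_iUnion fun n => countable_iUnion fun m => hDc n m,
    Cp.mem_closure_iff.2 fun n x ε hε => ?_⟩
  obtain ⟨m, hm⟩ := exists_nat_one_div_lt hε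
  obtain ⟨g, hg, hgx⟩ := hD n m x
  exact ⟨g, mem_iUnion₂.2 ⟨n, m, hg⟩, fun i => (hgx i).trans hm⟩

theorem Cp.separableSpace {e : X → ℝ} (he : Continuous e) (hinj : Function.Injective e) :
    SeparableSpace (Cp X) := by
  classical
  let Φ : C(ℝ, ℝ) → Cp X := fun p => ⟨fun x => p (e x), p.continuous.comp he⟩
  have hΦ : Continuous Φ :=
    Continuous.subtype_mk (continuous_pi fun x => continuous_eval_const (e x)) _
  have hd : DenseRange Φ := by
    intro f
    refine Cp.mem_closure_iff.2 fun n x ε hε => ?_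
    -- interpolate at the nodes `e (x i)`, which are distinct for distinct `x i`
    let s : Finset X := Finset.univ.image x
    let p := Lagrange.interpolate s e f.1
    refine ⟨Φ p.toContinuousMap, mem_range_self _, fun i => ?_⟩
    have : p.eval (e (x i)) = f.1 (x i) :=
      Lagrange.eval_interpolate_at_node _ hinj.injOn
        (Finset.mem_image_of_mem x (Finset.mem_univ i))
    change dist (p.eval (e (x i))) _ < ε
    rwa [this, dist_self]
  exact hd.separableSpace hΦ

/-- The indicators of the isolated points form a discrete subspace of `C_p(X)`. -/
theorem Cp.not_hereditarilySeparable [T1Space X]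
    (hX : ¬ {x : X | IsOpen ({x} : Set X)}.Countable) : ¬ HereditarilySeparable (Cp X) := by
  classical
  intro h
  let S := {x : X | IsOpen ({x} : Set X)}
  let χ : S → Cp X := fun b => ⟨Set.indicator {b.1} fun _ => 1,
    continuous_const.indicator fun a ha => by
      simp [IsClopen.frontier_eq ⟨isClosed_singleton, b.2⟩] at ha⟩
  have hχ : ∀ b c : S, 0 < (χ c).1 b.1 ↔ c = b := by
    intro b c
    change 0 < Set.indicator {c.1} (fun _ => (1 : ℝ)) b.1 ↔ _
    by_cases hbc : c = b
    · simp [hbc]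
    · have : b.1 ∉ ({c.1} : Set X) := fun hb => hbc (Subtype.ext hb.symm)
      simp [hbc, Set.indicator_of_notMem this]
  have hinj : Function.Injective χ := fun b c hbc =>
    (hχ c b).1 (hbc ▸ (hχ c c).2 rfl)
  have hdisc : DiscreteTopology (range χ) := by
    refine discreteTopology_iff_isOpen_singleton.2 ?_
    rintro ⟨_, b, rfl⟩
    refine ⟨{f | 0 < f.1 b.1}, isOpen_lt continuous_const (Cp.continuous_eval _), ?_⟩
    ext ⟨_, c, rfl⟩
    exact (hχ b c).trans ⟨fun hcb => Subtype.ext (congrArg χ hcb),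
      fun hcb => hinj (congrArg Subtype.val hcb)⟩
  have := h (range χ)
  have hc : Countable (range χ) := separableSpace_iff_countable.1 this
  have : Countable S := (rangeFactorization_injective.2 hinj).countable
  exact hX (countable_coe_iff.1 this)

end Cp

theorem CountablyTight.denseSeparable {X : Type*} [TopologicalSpace X] [SeparableSpace X]
    (hX : CountablyTight X) : DenseSeparable X := by
  intro D hD
  obtain ⟨S, hSc, hS⟩ := exists_countable_dense X
  choose E hED hEc hE using fun s : X => hX D s (hD s)
  have hdense : Dense (⋃ s ∈ S, E s) := by
    refine dense_closure.1 (hS.mono fun s hs => ?_)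
    exact closure_mono (subset_biUnion_of_mem hs) (hE s)
  have hsub : ⋃ s ∈ S, E s ⊆ D := iUnion₂_subset fun s _ => hED s
  refine ⟨(↑) ⁻¹' (⋃ s ∈ S, E s),
    (hSc.biUnion fun s _ => hEc s).preimage Subtype.val_injective, fun x => ?_⟩
  rw [closure_subtype, Subtype.image_preimage_coe, inter_eq_self_of_subset_right hsub]
  exact hdense x

theorem mainTheorem10 :
    ∃ B : Set ℝ, IsBernstein B ∧ (∀ b ∈ B, Irrational b) ∧
      ¬ HereditarilyLindelofSpace (MichaelLine B) ∧
      IsTopologicalAddGroup (Cp (MichaelLine B)) ∧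
      T2Space (Cp (MichaelLine B)) ∧
      SeparableSpace (Cp (MichaelLine B)) ∧
      CountablyTight (Cp (MichaelLine B)) ∧
      DenseSeparable (Cp (MichaelLine B)) ∧
      ¬ HereditarilySeparable (Cp (MichaelLine B)) := by
  obtain ⟨B, hirr, hB⟩ := exists_coordinatewise_bernstein
  have hBern : IsBernstein B := isBernstein_of_forall_fin_one (hB 1)
  have hsep : SeparableSpace (Cp (MichaelLine B)) :=
    Cp.separableSpace MichaelLine.continuous_toReal MichaelLine.toReal_injective
  have htight : CountablyTight (Cp (MichaelLine B)) :=
    Cp.countablyTight (MichaelLine.lindelofSpace_pi fun n C hcl hC => (hB n C hcl hC).2)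
  refine ⟨B, hBern, hirr, MichaelLine.not_hereditarilyLindelofSpace hBern.not_countable,
    inferInstance, inferInstance, hsep, htight, htight.denseSeparable,
    Cp.not_hereditarilySeparable fun h => hBern.not_countable (h.mono fun b hb => ?_)⟩
  exact MichaelLine.isOpen_singleton hb
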